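/- Consider the noiseless binary energy harvesting channel with a unit-sized battery. In channel use $i=1,2,\dots$ the encoder observes the battery state $S_i\in\{0,1\}$, sends $X_i\in\{0,1\}$, where $X_i=1$ is allowed only if $S_i=1$, and then harvests $E_i$ units of energy; here $E_1,E_2,\dots$ are i.i.d. Bernoulli($q$) with $0<q\le1$, and $S_{i+1}=\min\{S_i-X_i+E_i,1\}$. The initial state $S_1$ is Bernoulli($r$), $0\le r\le1$, and the message (uniform on $\{1,\dots,M\}$), $S_1$ and $(E_i)_i$ are independent. The encoder knows the battery states causally ($X_i$ is a function of the message and $S_1,\dots,S_i$); the decoder observes only $Y^n=X^n$. Let $C_{\mathrm{BEHC}}$ be the capacity in bits per channel use, i.e. the supremum of the rates $R$ for which there are codes of block length $n$ with at least $2^{nR}$ messages and error probability tending to $0$ as $n\to\infty$. Let $Z_k$ be the idle times, i.e. $Z_k$ is the number of channel uses with empty battery after the $(k-1)$st and up to the $k$th transmitted $1$ (or up to the end of the block; for $k=1$ counted from its beginning), and let $C_{UB}^{\mathrm{genie}}$ be the capacity of the same channel if a genie also reveals the idle times $Z_1,Z_2,\dots$ within the block to the decoder. Let $H$ denote Shannon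 entropy and $H_2$ the binary entropy function, both in bits, and let $Z$ be geometric with parameter $q$ on $\{0,1,2,\dots\}$, so that $\mathbb E[Z]=(1-q)/q$. Then $$C_{\mathrm{BEHC}}\ \le\ C_{UB}^{\mathrm{genie}}=\max_{p_V}\frac{H(V)}{\mathbb E[V]+\mathbb E[Z]}=\max_{\mu\ge1}\ \frac{1}{\mu+\mathbb E[Z]}\ \sup_{\mathbb E[V]\le\mu}H(V)=\max_{p\in[0,1]}\frac{q\,H_2(p)}{q+p(1-q)},$$ where $V$ ranges over random variables on $\{1,2,\dots\}$ with finite mean. Moreover, for every $\mu\ge1$ the geometric law on $\{1,2,\dots\}$ with parameter $p=1/\mu$ has mean $\mu$ and entropy $H_2(p)/p$, and it maximizes $H(V)$ among all laws of $V$ on $\{1,2,\dots\}$ with $\mathbb E[V]\le\mu$. -/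

import Mathlib

open scoped ENNReal NNReal

namespace BEHC

noncomputable section

/-! ### The channel: battery, encoders, output sequences -/

/-- Next state of a unit-sized battery in state `s` after sending the symbol `x` and then harvesting
`e` units (transmit first); `true` stands for one unit of energy, or for the symbol 1. -/
def nextBattery (s x e : Bool) : Bool := (s && !x) || e

/-- `nextBattery` is the update `S' = min {S - X + E, 1}` (here `X = 1` requires `S = 1`). -/
theorem nextBattery_eq_min (s x e : Bool) (h : s = false → x = false) :
    (nextBattery s x e).toNat = min (s.toNat - x.toNat + e.toNat) 1 := by
  revert h; cases s <;> cases x <;> cases e <;> decide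

/-- An encoder for `M` messages with causal knowledge of the battery state. In channel use `i` it
maps the message, the list of the previous battery states (most recent first) and the current
battery state to the channel input. It never sends a 1 on an empty battery. -/
structure Encoder (M : ℕ) where
  enc : Fin M → List Bool → Bool → Bool
  energy : ∀ w past, enc w past false = false

/-- The previous battery states (most recent first) and the current battery state at channel use
`i` (counted from 0), if message `w` is sent, the initial battery state is `s₁`, and `e j` is
harvested in channel use `j`. -/
def Encoder.path {M : ℕ} (c : Encoder M) (w : Fin M) (s₁ : Bool) (e : ℕ → Bool) :
    ℕ → List Bool × Bool
  | 0 => ([], s₁)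
  | i + 1 =>
    let past := (c.path w s₁ e i).1
    let s := (c.path w s₁ e i).2
    (s :: past, nextBattery s (c.enc w past s) (e i))

/-- Battery state at the beginning of channel use `i`. -/
def Encoder.state {M : ℕ} (c : Encoder M) (w : Fin M) (s₁ : Bool) (e : ℕ → Bool) (i : ℕ) : Bool :=
  (c.path w s₁ e i).2

/-- Channel input in channel use `i`; since the channel is noiseless, also the channel output. -/
def Encoder.input {M : ℕ} (c : Encoder M) (w : Fin M) (s₁ : Bool) (e : ℕ → Bool) (i : ℕ) : Bool :=
  c.enc w (c.path w s₁ e i).1 (c.path w s₁ e i).2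

/-- A finite harvesting sequence, extended by zeros (the extension plays no role within the
first `n` channel uses). -/
def extend {n : ℕ} (e : Fin n → Bool) : ℕ → Bool :=
  fun i => if h : i < n then e ⟨i, h⟩ else false

/-! ### What the decoder observes -/

/-- The idle time after the `k`-th 1 in a block of `n` channel uses (`k = 0`: from the start of the
block): the number of channel uses with an empty battery that are preceded by exactly `k` ones. -/
def idleTime {n : ℕ} (y s : Fin n → Bool) (k : ℕ) : ℕ :=
  (Finset.univ.filter fun i : Fin n =>
    s i = false ∧ (Finset.univ.filter fun j : Fin n => j < i ∧ y j = true).card = k).card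

/-- A kind of decoder observation: for each block length `n`, a function of the channel outputs and
the battery states. -/
structure Observation where
  Obs : ℕ → Type
  obs : ∀ n, (Fin n → Bool) → (Fin n → Bool) → Obs n

/-- The decoder of the actual channel observes the channel outputs only. -/
def outputOnly : Observation where
  Obs n := Fin n → Bool
  obs _ y _ := y

/-- The genie-aided decoder observes the channel outputs and the idle times. -/
def outputAndIdleTimes : Observation where
  Obs n := (Fin n → Bool) × (ℕ → ℕ)
  obs _ y s := (y, idleTime y s)

/-! ### Operational capacity -/

/-- Probability mass function of a Bernoulli(`q`) bit. -/
def bernoulliWeight (q : ℝ) (b : Bool) : ℝ := if b then q else 1 - q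

/-- Probability of decoding error over `n` channel uses for a uniformly distributed message,
an independent Bernoulli(`r`) initial battery state and i.i.d. Bernoulli(`q`) harvests. -/
def errorProb (q r : ℝ) {n M : ℕ} (D : Observation) (c : Encoder M) (dec : D.Obs n → Fin M) : ℝ :=
  (1 / (M : ℝ)) * ∑ w : Fin M, ∑ s₁ : Bool, ∑ e : Fin n → Bool,
    bernoulliWeight r s₁ * (∏ i, bernoulliWeight q (e i)) *
      (if dec (D.obs n (fun i => c.input w s₁ (extend e) i) (fun i => c.state w s₁ (extend e) i)) = w
        then 0 else 1)

/-- The rate `R` (in bits per channel use) is achievable: for all large block lengths `n` there are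
codes with at least `2 ^ (n R)` messages, with error probabilities tending to zero. -/
def IsAchievable (q r : ℝ) (D : Observation) (R : ℝ≥0) : Prop :=
  ∀ ε : ℝ, 0 < ε → ∃ N : ℕ, ∀ n : ℕ, N ≤ n →
    ∃ (M : ℕ) (c : Encoder M) (dec : D.Obs n → Fin M),
      (2 : ℝ) ^ ((n : ℝ) * (R : ℝ)) ≤ (M : ℝ) ∧ errorProb q r D c dec ≤ ε

/-- Supremum of the achievable rates, in bits per channel use. -/
def capacityWith (q r : ℝ) (D : Observation) : ℝ≥0∞ :=
  ⨆ (R : ℝ≥0) (_ : IsAchievable q r D R), (R : ℝ≥0∞)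

/-- Capacity of the noiseless binary energy harvesting channel with unit-sized battery, harvest
probability `q` and Bernoulli(`r`) initial battery state. -/
def capacity (q r : ℝ) : ℝ≥0∞ := capacityWith q r outputOnly

/-- Capacity of the same channel if a genie reveals the idle times to the decoder. -/
def genieCapacity (q r : ℝ) : ℝ≥0∞ := capacityWith q r outputAndIdleTimes

/-! ### Entropy, mean, geometric laws -/

/-- Binary entropy function in bits. -/
def binEntropyBits (p : ℝ) : ℝ := Real.binEntropy p / Real.log 2

/-- Shannon entropy in bits, possibly infinite. -/
def entropyBits {α : Type*} (P : PMF α) : ℝ≥0∞ :=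
  ∑' a, ENNReal.ofReal (Real.negMulLog (P a).toReal / Real.log 2)

/-- Mean of a law on `{0, 1, 2, …}`, possibly infinite. -/
def meanNat (P : PMF ℕ) : ℝ≥0∞ := ∑' k : ℕ, (k : ℝ≥0∞) * P k

/-- Mean of a law on `{1, 2, 3, …}`, possibly infinite. -/
def meanPos (P : PMF ℕ+) : ℝ≥0∞ := ∑' v : ℕ+, ((v : ℕ) : ℝ≥0∞) * P v

/-- Geometric law on `{0, 1, 2, …}` with parameter `p`. -/
def geomNat (p : unitInterval) : PMF ℕ := (ProbabilityTheory.geometricMeasure p).toPMF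

/-- Geometric law on `{1, 2, 3, …}` with parameter `p`. -/
def geomPos (p : unitInterval) : PMF ℕ+ := (geomNat p).map Nat.succPNat

end

end BEHC

namespace BEHC

open Real

/-! ### Gibbs' inequality and geometric laws -/

/-! Count time in expectation. A zero sent on a full battery takes one channel use; a one takes one
use plus `(1 - q) / q` expected idle uses, `1 / q` in all. A decoder that knows the battery states
thus faces a noiseless channel with symbol durations `1` and `1 / q`. Its capacity in nats is
Shannon's root `a` of `exp (-a) + exp (-(a / q)) = 1`, and every maximum in the theorem equals `a /
log 2`.

Entropy side: the geometric law with parameter `exp (-(a / q))` gives `v` the probability `exp (-a *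
(v + E[Z]))`, so Gibbs' inequality bounds `H(V)` by `a * (E[V] + E[Z])` nats, with equality for this
law (`entropyBits_le_critical`, `geomPos_critical`).

Operational side: for any encoder, cost in expected time minus elapsed time is, up to `1 / q`, a
martingale with second moment at most `n / q ^ 2` (`expect_balance_sq_le`), so the cost of `n` uses
concentrates at `n`. Converse: a memoryless policy gives each input sequence probability `exp (-a *
cost)`; for fixed harvests the correctly decoded messages have distinct sequences, so these weights
sum to at most one (`sum_correct_le`). Achievability: idle times reveal the states
(`states_eq_of_idleTime_eq`), so constant-weight words, one bit per full-battery use, are read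
without error unless the block ends too early. -/

theorem exists_exp_add_exp_eq_one {q : ℝ} (hq : 0 < q) (hq1 : q ≤ 1) :
    ∃ c : ℝ, 0 < c ∧ exp (-c) + exp (-(c / q)) = 1 := by
  have hcont : ContinuousOn (fun c : ℝ => exp (-c) + exp (-(c / q))) (Set.Icc 0 (log 2)) := by
    fun_prop
  have hlog : (0 : ℝ) ≤ log 2 := log_nonneg (by norm_num)
  have hhalf : exp (-log 2) = 1 / 2 := by rw [exp_neg, exp_log (by norm_num)]; norm_num
  have hle : exp (-(log 2 / q)) ≤ 1 / 2 := by
    rw [← hhalf, exp_le_exp, neg_le_neg_iff, le_div_iff₀ hq]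
    nlinarith
  -- The sum is `2` at `0` and at most `1` at `log 2`, because `q ≤ 1`.
  obtain ⟨c, hc, h⟩ := intermediate_value_Icc' hlog hcont
    (show (1 : ℝ) ∈ Set.Icc _ _ from ⟨by linarith, by norm_num⟩)
  refine ⟨c, lt_of_le_of_ne hc.1 ?_, h⟩
  rintro rfl
  norm_num at h

/-- This is `log x ≤ x - 1` at `x = b / a`. The term `b - a` is kept because its sum over a law `a`
and a subprobability `b` is at most zero. -/
theorem negMulLog_le_cross {a b : ℝ} (ha : 0 ≤ a) (hb : 0 < b) :
    negMulLog a ≤ a * (-log b) + b - a := by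
  rcases ha.eq_or_lt with rfl | ha
  · simp [hb.le]
  · have h := log_le_sub_one_of_pos (div_pos hb ha)
    rw [log_div hb.ne' ha.ne'] at h
    have := mul_le_mul_of_nonneg_left h ha.le
    rw [mul_sub a (b / a), mul_div_cancel₀ _ ha.ne'] at this
    rw [negMulLog]
    linarith

theorem binEntropy_le_cross {x p : ℝ} (hx : 0 ≤ x) (hx1 : x ≤ 1) (hp : 0 < p) (hp1 : p < 1) :
    binEntropy x ≤ x * (-log p) + (1 - x) * (-log (1 - p)) := by
  rw [binEntropy_eq_negMulLog_add_negMulLog_one_sub]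
  linarith [negMulLog_le_cross hx hp,
    negMulLog_le_cross (sub_nonneg.2 hx1) (sub_pos.2 hp1)]

/-- The mean of `V - 1`. -/
noncomputable def meanPred (P : PMF ℕ+) : ℝ≥0∞ := ∑' v : ℕ+, (v.natPred : ℝ≥0∞) * P v

theorem meanPos_eq (P : PMF ℕ+) : meanPos P = 1 + meanPred P := by
  rw [meanPos, meanPred, ← P.tsum_coe, ← ENNReal.tsum_add]
  congr 1 with v
  conv_lhs => rw [← PNat.natPred_add_one v]
  push_cast
  ring

theorem tsum_cross (P : PMF ℕ+) {a b : ℝ} (ha : 0 ≤ a) (hb : 0 ≤ b) :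
    ∑' v : ℕ+, ENNReal.ofReal ((P v).toReal * (a + b * v.natPred) / log 2) =
      ENNReal.ofReal (a / log 2) + ENNReal.ofReal (b / log 2) * meanPred P := by
  have hlog : (0 : ℝ) < log 2 := log_pos (by norm_num)
  have : ∀ v : ℕ+, ENNReal.ofReal ((P v).toReal * (a + b * v.natPred) / log 2) =
      ENNReal.ofReal (a / log 2) * P v + ENNReal.ofReal (b / log 2) * (v.natPred * P v) := by
    intro v
    have h1 : (P v).toReal * (a + b * v.natPred) / log 2 =
      a / log 2 * (P v).toReal + b / log 2 * (v.natPred * (P v).toReal) := by ring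
    rw [h1, ENNReal.ofReal_add (by positivity) (by positivity), ENNReal.ofReal_mul (by positivity),
      ENNReal.ofReal_mul (by positivity), ENNReal.ofReal_mul (by positivity),
      ENNReal.ofReal_toReal (P.apply_ne_top v), ENNReal.ofReal_natCast]
  simp_rw [this]
  rw [ENNReal.tsum_add, ENNReal.tsum_mul_left, ENNReal.tsum_mul_left, P.tsum_coe, mul_one, meanPred]

/-- Against weights whose logarithm is affine in `v`, the cross entropy depends on the law only
through its mean. -/
theorem entropyBits_le_cross (P : PMF ℕ+) {a b : ℝ} (ha : 0 ≤ a) (hb : 0 ≤ b)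
    (h : ∑' v : ℕ+, ENNReal.ofReal (exp (-(a + b * v.natPred))) ≤ 1) :
    entropyBits P ≤ ENNReal.ofReal (a / log 2) + ENNReal.ofReal (b / log 2) * meanPred P := by
  have hlog : (0 : ℝ) < log 2 := log_pos (by norm_num)
  set L : ℝ≥0∞ := ENNReal.ofReal (1 / log 2) with hL
  have hLtop : L ≠ ⊤ := ENNReal.ofReal_ne_top
  rw [← tsum_cross P ha hb]
  -- The correction `b - a` in Gibbs' inequality has no sign, so its two halves go to opposite
  -- sides. Each sums to at most `L`, which is finite and cancels.
  refine (ENNReal.add_le_add_iff_right hLtop).1 ?_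
  calc entropyBits P + L
      = ∑' v : ℕ+, (ENNReal.ofReal (negMulLog (P v).toReal / log 2) + L * P v) := by
        rw [ENNReal.tsum_add, ENNReal.tsum_mul_left, P.tsum_coe, mul_one, entropyBits]
    _ ≤ ∑' v : ℕ+, (ENNReal.ofReal ((P v).toReal * (a + b * v.natPred) / log 2) +
          L * ENNReal.ofReal (exp (-(a + b * v.natPred)))) := by
        refine ENNReal.tsum_le_tsum fun v => ?_
        have h1 : (P v).toReal ≤ 1 := ENNReal.toReal_le_of_le_ofReal (by norm_num)
          (by simpa using P.coe_le_one v)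
        have h0 : 0 ≤ (P v).toReal := ENNReal.toReal_nonneg
        have hn := negMulLog_nonneg h0 h1
        have hc := negMulLog_le_cross h0 (exp_pos (-(a + b * v.natPred)))
        rw [log_exp, neg_neg] at hc
        have hPv : L * P v = L * ENNReal.ofReal (P v).toReal := by
          rw [ENNReal.ofReal_toReal (P.apply_ne_top v)]
        rw [hPv, hL, ← ENNReal.ofReal_mul (by positivity), ← ENNReal.ofReal_mul (by positivity),
          ← ENNReal.ofReal_add (by positivity) (by positivity),
          ← ENNReal.ofReal_add (by positivity) (by positivity)]
        refine ENNReal.ofReal_le_ofReal ?_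
        rw [div_mul_eq_mul_div, div_mul_eq_mul_div, ← add_div, ← add_div]
        exact div_le_div_of_nonneg_right (by linarith) hlog.le
    _ ≤ _ := by
        rw [ENNReal.tsum_add, ENNReal.tsum_mul_left]
        gcongr
        exact mul_le_of_le_one_right' h

theorem entropyBits_eq_cross (P : PMF ℕ+) {a b : ℝ} (ha : 0 ≤ a) (hb : 0 ≤ b)
    (h : ∀ v : ℕ+, P v = ENNReal.ofReal (exp (-(a + b * v.natPred)))) :
    entropyBits P = ENNReal.ofReal (a / log 2) + ENNReal.ofReal (b / log 2) * meanPred P := by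
  rw [← tsum_cross P ha hb, entropyBits]
  congr 1 with v
  rw [h v, ENNReal.toReal_ofReal (exp_pos _).le, negMulLog, log_exp]
  congr 2
  ring

theorem geomNat_apply {p : unitInterval} (hp : 0 < p) (n : ℕ) :
    geomNat p n = ENNReal.ofReal ((1 - (p : ℝ)) ^ n * p) := by
  rw [geomNat, MeasureTheory.Measure.toPMF_apply,
    ProbabilityTheory.geometricMeasure_singleton hp.ne']

theorem geomPos_apply (p : unitInterval) (v : ℕ+) : geomPos p v = geomNat p v.natPred := by
  rw [geomPos, PMF.map_apply, tsum_eq_single v.natPred]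
  · simp
  · intro n hn
    rw [if_neg]
    rintro rfl
    simp at hn

theorem meanNat_geomNat {p : unitInterval} (hp : 0 < p) :
    meanNat (geomNat p) = ENNReal.ofReal ((1 - (p : ℝ)) / p) := by
  have hp0 : 0 < (p : ℝ) := hp
  have hp1 : (p : ℝ) ≤ 1 := p.2.2
  have hs := (hasSum_coe_mul_geometric_of_norm_lt_one (r := 1 - (p : ℝ)) (by
    rw [norm_eq_abs, abs_lt]; constructor <;> linarith)).mul_right (p : ℝ)
  rw [show (1 - (p : ℝ)) / (1 - (1 - p)) ^ 2 * p = (1 - p) / p by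
    rw [sub_sub_cancel]; field_simp] at hs
  have h1p : 0 ≤ 1 - (p : ℝ) := by linarith
  rw [← hs.tsum_eq, ENNReal.ofReal_tsum_of_nonneg (fun n => by positivity) hs.summable, meanNat]
  congr 1 with n
  rw [geomNat_apply hp, mul_assoc, ENNReal.ofReal_mul (Nat.cast_nonneg n), ENNReal.ofReal_natCast]

theorem meanPred_geomPos (p : unitInterval) : meanPred (geomPos p) = meanNat (geomNat p) := by
  simp_rw [meanPred, meanNat, geomPos_apply]
  exact Equiv.pnatEquivNat.tsum_eq (fun n : ℕ => (n : ℝ≥0∞) * geomNat p n)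

theorem meanPos_geomPos {p : unitInterval} (hp : 0 < p) :
    meanPos (geomPos p) = ENNReal.ofReal (1 / p) := by
  have hp0 : 0 < (p : ℝ) := hp
  have hp1 : (p : ℝ) ≤ 1 := p.2.2
  rw [meanPos_eq, meanPred_geomPos, meanNat_geomNat hp, ← ENNReal.ofReal_one,
    ← ENNReal.ofReal_add zero_le_one (div_nonneg (by linarith) hp0.le)]
  congr 1
  field_simp
  ring

theorem geomPos_apply_eq_exp {p : unitInterval} (hp : 0 < p) (hp1 : p < 1) (v : ℕ+) :
    geomPos p v = ENNReal.ofReal (exp (-(-log p + -log (1 - p) * v.natPred))) := by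
  have hp0 : 0 < (p : ℝ) := hp
  have hp1 : (p : ℝ) < 1 := hp1
  rw [geomPos_apply, geomNat_apply hp]
  congr 1
  rw [show -(-log (p : ℝ) + -log (1 - p) * v.natPred) = v.natPred * log (1 - p) + log p by ring,
    exp_add, exp_log hp0, exp_nat_mul, exp_log (by linarith)]

theorem entropyBits_le_geom {p : unitInterval} (hp : 0 < p) (hp1 : p < 1) (P : PMF ℕ+) :
    entropyBits P ≤ ENNReal.ofReal (-log p / log 2) +
      ENNReal.ofReal (-log (1 - p) / log 2) * meanPred P := by
  have hp0 : 0 < (p : ℝ) := hp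
  have hp1' : (p : ℝ) < 1 := hp1
  refine entropyBits_le_cross P (neg_nonneg.2 (log_nonpos hp0.le hp1'.le))
    (neg_nonneg.2 (log_nonpos (by linarith) (by linarith))) ?_
  simp_rw [← geomPos_apply_eq_exp hp hp1]
  exact (PMF.tsum_coe _).le

theorem entropyBits_geomPos_eq {p : unitInterval} (hp : 0 < p) (hp1 : p < 1) :
    entropyBits (geomPos p) = ENNReal.ofReal (-log p / log 2) +
      ENNReal.ofReal (-log (1 - p) / log 2) * meanPred (geomPos p) := by
  have hp0 : 0 < (p : ℝ) := hp
  have hp1' : (p : ℝ) < 1 := hp1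
  exact entropyBits_eq_cross _ (neg_nonneg.2 (log_nonpos hp0.le hp1'.le))
    (neg_nonneg.2 (log_nonpos (by linarith) (by linarith))) (geomPos_apply_eq_exp hp hp1)

/-- A law with mean at most one is concentrated at a point, so its entropy vanishes. -/
theorem entropyBits_eq_zero_of_meanPos_le_one (P : PMF ℕ+) (h : meanPos P ≤ 1) :
    entropyBits P = 0 := by
  have h0 : meanPred P = 0 := by
    rw [meanPos_eq] at h
    have : 1 + meanPred P ≤ 1 + 0 := by simpa using h
    simpa using (ENNReal.add_le_add_iff_left ENNReal.one_ne_top).1 this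
  have hv : ∀ v : ℕ+, v ≠ 1 → P v = 0 := by
    intro v hv
    have := ENNReal.tsum_eq_zero.1 h0 v
    rcases mul_eq_zero.1 this with h | h
    · refine absurd ?_ hv
      have h' : v.natPred = 0 := by exact_mod_cast h
      rw [← PNat.succPNat_natPred v, h']
      rfl
    · exact h
  have h1 : P 1 = 1 := by
    have := P.tsum_coe
    rwa [tsum_eq_single 1 (fun v h => hv v h)] at this
  refine ENNReal.tsum_eq_zero.2 fun v => ?_
  by_cases hv1 : v = 1
  · rw [hv1, h1]; simp
  · rw [hv v hv1]; simp

theorem entropyBits_geomPos {p : unitInterval} (hp : 0 < p) :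
    entropyBits (geomPos p) = ENNReal.ofReal (binEntropyBits p / p) := by
  have hp0 : 0 < (p : ℝ) := hp
  rcases p.2.2.eq_or_lt with h1 | hp1
  · rw [entropyBits_eq_zero_of_meanPos_le_one _ (by simp [meanPos_geomPos hp, h1]), h1]
    simp [binEntropyBits]
  · rw [entropyBits_geomPos_eq hp hp1, meanPred_geomPos, meanNat_geomNat hp]
    have hlog : (0 : ℝ) < log 2 := log_pos (by norm_num)
    have ha : 0 ≤ -log (p : ℝ) := neg_nonneg.2 (log_nonpos hp0.le hp1.le)
    have hb : 0 ≤ -log (1 - (p : ℝ)) := neg_nonneg.2 (log_nonpos (by linarith) (by linarith))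
    have h1p : 0 ≤ 1 - (p : ℝ) := by linarith
    rw [← ENNReal.ofReal_mul (by positivity), ← ENNReal.ofReal_add (by positivity) (by positivity)]
    congr 1
    rw [binEntropyBits, binEntropy, log_inv, log_inv]
    field_simp

/-- The Gibbs bound against the geometric law increases with the mean and is attained at mean `1 / p
= μ`. The case `μ = 1` is separate because `log (1 - p)` degenerates there. -/
theorem entropyBits_le_geomPos {μ : ℝ} {p : unitInterval} (hμ : 1 ≤ μ) (hp : (p : ℝ) = 1 / μ)
    (P : PMF ℕ+) (hP : meanPos P ≤ ENNReal.ofReal μ) :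
    entropyBits P ≤ entropyBits (geomPos p) := by
  have hp0 : 0 < p := by
    change 0 < (p : ℝ)
    rw [hp]; positivity
  rcases p.2.2.eq_or_lt with h1 | hp1
  · have : μ = 1 := by
      rw [hp] at h1
      field_simp at h1
      exact h1.symm
    rw [entropyBits_eq_zero_of_meanPos_le_one P (by simpa [this] using hP)]
    exact zero_le
  · rw [entropyBits_geomPos_eq hp0 hp1]
    refine (entropyBits_le_geom hp0 hp1 P).trans ?_
    gcongr
    have := meanPos_geomPos hp0
    rw [hp, one_div_one_div, meanPos_eq] at this
    rw [meanPos_eq, ← this] at hP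
    exact (ENNReal.add_le_add_iff_left ENNReal.one_ne_top).1 hP

/-- Gibbs' inequality against the critical geometric law, in bits. -/
theorem entropyBits_le_critical {q : unitInterval} (hq : 0 < q) {c : ℝ} (hc : 0 < c)
    (h : exp (-c) + exp (-(c / q)) = 1) (P : PMF ℕ+) :
    entropyBits P ≤ ENNReal.ofReal (c / log 2) * (meanPos P + meanNat (geomNat q)) := by
  have hq0 : 0 < (q : ℝ) := hq
  have hlog : (0 : ℝ) < log 2 := log_pos (by norm_num)
  have h1 : exp (-(c / q)) = 1 - exp (-c) := by linarith
  have hlt : exp (-(c / (q : ℝ))) < 1 := by linarith [exp_pos (-c)]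
  let p : unitInterval := ⟨exp (-(c / q)), (exp_pos _).le, hlt.le⟩
  refine (entropyBits_le_geom (p := p) (exp_pos _) hlt P).trans_eq ?_
  have hp : (p : ℝ) = exp (-(c / q)) := rfl
  have hq1 : 0 ≤ 1 - (q : ℝ) := sub_nonneg.2 q.2.2
  rw [hp, show 1 - exp (-(c / (q : ℝ))) = exp (-c) by linarith, log_exp, log_exp, neg_neg, neg_neg,
    meanPos_eq, meanNat_geomNat hq, mul_add, mul_add, mul_one, add_right_comm,
    ← ENNReal.ofReal_mul (by positivity), ← ENNReal.ofReal_add (by positivity) (by positivity)]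
  congr 2
  field_simp
  ring

/-! ### The closed form as a function of the geometric parameter -/

theorem closed_form_le {q : ℝ} (hq : 0 < q) (hq1 : q ≤ 1) {c : ℝ} (hc : 0 < c)
    (h : exp (-c) + exp (-(c / q)) = 1) {x : ℝ} (hx : 0 ≤ x) (hx1 : x ≤ 1) :
    q * binEntropyBits x / (q + x * (1 - q)) ≤ c / log 2 := by
  have hlog : (0 : ℝ) < log 2 := log_pos (by norm_num)
  -- The cross entropy against the critical parameter is `x * (c / q) + (1 - x) * c`, which is `c /
  -- q` times the denominator.
  have hb := binEntropy_le_cross hx hx1 (exp_pos (-(c / q))) (by linarith [exp_pos (-c)])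
  rw [show 1 - exp (-(c / q)) = exp (-c) by linarith, log_exp, log_exp, neg_neg, neg_neg] at hb
  have hd : 0 < q + x * (1 - q) := by nlinarith [mul_nonneg hx (sub_nonneg.2 hq1)]
  rw [binEntropyBits, div_le_div_iff₀ hd hlog, mul_assoc, div_mul_cancel₀ _ hlog.ne']
  refine (mul_le_mul_of_nonneg_left hb hq.le).trans_eq ?_
  field_simp
  ring

theorem closed_form_critical {q : ℝ} (hq : 0 < q) (hq1 : q ≤ 1) {c : ℝ}
    (h : exp (-c) + exp (-(c / q)) = 1) :
    q * binEntropyBits (exp (-(c / q))) / (q + exp (-(c / q)) * (1 - q)) = c / log 2 := by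
  have hlog : (0 : ℝ) < log 2 := log_pos (by norm_num)
  have hd : 0 < q + exp (-(c / q)) * (1 - q) := by
    nlinarith [mul_nonneg (exp_pos (-(c / q))).le (sub_nonneg.2 hq1)]
  rw [binEntropyBits, binEntropy, log_inv, log_inv, show 1 - exp (-(c / q)) = exp (-c) by linarith,
    log_exp, log_exp, neg_neg, neg_neg, show exp (-c) = 1 - exp (-(c / q)) by linarith]
  field_simp
  ring

/-! ### Expectations over finitely many harvests -/

theorem bernoulliWeight_nonneg (q : unitInterval) (b : Bool) : 0 ≤ bernoulliWeight q b := by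
  have := q.2.1
  have := q.2.2
  cases b <;> simp [bernoulliWeight, *]

theorem sum_bernoulliWeight (q : ℝ) : ∑ b, bernoulliWeight q b = 1 := by
  simp [bernoulliWeight]

/-- Expectation of a function of the first `n` harvests. -/
noncomputable def expect (q : ℝ) (n : ℕ) (F : (ℕ → Bool) → ℝ) : ℝ :=
  ∑ e : Fin n → Bool, (∏ i, bernoulliWeight q (e i)) * F (extend e)

theorem extend_snoc_lt {n : ℕ} (e : Fin n → Bool) (b : Bool) {i : ℕ} (hi : i < n) :
    extend (Fin.snoc e b : Fin (n + 1) → Bool) i = extend e i := by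
  have h := Fin.snoc_castSucc (α := fun _ => Bool) b e ⟨i, hi⟩
  simp only [extend, dif_pos hi, dif_pos (Nat.lt_succ_of_lt hi)]
  exact h

theorem extend_snoc_last {n : ℕ} (e : Fin n → Bool) (b : Bool) :
    extend (Fin.snoc e b : Fin (n + 1) → Bool) n = b := by
  have h := Fin.snoc_last (α := fun _ => Bool) b e
  simp only [extend, dif_pos (Nat.lt_succ_self n)]
  exact h

theorem sum_fin_succ_bool {n : ℕ} (F : (Fin (n + 1) → Bool) → ℝ) :
    ∑ e, F e = ∑ e : Fin n → Bool, ∑ b : Bool, F (Fin.snoc e b) := by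
  rw [← (Fin.snocEquiv fun _ => Bool).sum_comp, Fintype.sum_prod_type, Finset.sum_comm]
  rfl

theorem expect_succ (q : ℝ) (n : ℕ) (F : (ℕ → Bool) → ℝ) :
    expect q (n + 1) F = ∑ e : Fin n → Bool, (∏ i, bernoulliWeight q (e i)) *
      ∑ b, bernoulliWeight q b * F (extend (Fin.snoc e b : Fin (n + 1) → Bool)) := by
  rw [expect, sum_fin_succ_bool]
  refine Finset.sum_congr rfl fun e _ => ?_
  rw [Finset.mul_sum]
  refine Finset.sum_congr rfl fun b _ => ?_
  rw [← mul_assoc]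
  congr 1
  rw [Fin.prod_univ_castSucc]
  simp

theorem prod_bernoulliWeight_nonneg (q : unitInterval) {n : ℕ} (e : Fin n → Bool) :
    0 ≤ ∏ i, bernoulliWeight q (e i) :=
  Finset.prod_nonneg fun _ _ => bernoulliWeight_nonneg q _

theorem expect_mono (q : unitInterval) (n : ℕ) {F G : (ℕ → Bool) → ℝ} (h : ∀ e, F e ≤ G e) :
    expect q n F ≤ expect q n G :=
  Finset.sum_le_sum fun _ _ => mul_le_mul_of_nonneg_left (h _) (prod_bernoulliWeight_nonneg q _)

theorem expect_const (q : ℝ) (n : ℕ) (a : ℝ) : expect q n (fun _ => a) = a := by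
  induction n with
  | zero => simp [expect]
  | succ n ih =>
    rw [expect_succ]
    simp_rw [← Finset.sum_mul, sum_bernoulliWeight, one_mul]
    rwa [Finset.sum_mul]

theorem expect_add (q : ℝ) (n : ℕ) (F G : (ℕ → Bool) → ℝ) :
    expect q n (fun e => F e + G e) = expect q n F + expect q n G := by
  simp [expect, mul_add, Finset.sum_add_distrib]

theorem expect_mul_left (q : ℝ) (n : ℕ) (a : ℝ) (F : (ℕ → Bool) → ℝ) :
    expect q n (fun e => a * F e) = a * expect q n F := by
  simp only [expect, Finset.mul_sum]
  exact Finset.sum_congr rfl fun _ _ => by ring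

theorem expect_sum {ι : Type*} (q : ℝ) (n : ℕ) (s : Finset ι) (F : ι → (ℕ → Bool) → ℝ) :
    ∑ w ∈ s, expect q n (F w) = expect q n (fun e => ∑ w ∈ s, F w e) := by
  simp only [expect, Finset.mul_sum]
  exact Finset.sum_comm

theorem errorProb_eq (q r : ℝ) {n M : ℕ} (D : Observation) (c : Encoder M)
    (dec : D.Obs n → Fin M) :
    errorProb q r D c dec = (1 / (M : ℝ)) * ∑ w : Fin M, ∑ s₁, bernoulliWeight r s₁ *
      expect q n (fun e => if dec (D.obs n (fun i => c.input w s₁ e i)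
        (fun i => c.state w s₁ e i)) = w then 0 else 1) := by
  simp only [errorProb, expect, Finset.mul_sum, mul_assoc]

/-! ### The balance martingale -/

section Martingale

variable {M : ℕ} (c : Encoder M) (w : Fin M) (s₁ : Bool)

theorem Encoder.path_congr {e e' : ℕ → Bool} {i : ℕ} (h : ∀ j < i, e j = e' j) :
    c.path w s₁ e i = c.path w s₁ e' i := by
  induction i with
  | zero => rfl
  | succ i ih =>
    simp only [Encoder.path, ih fun j hj => h j (by omega), h i (by omega)]

theorem Encoder.state_congr {e e' : ℕ → Bool} {i : ℕ} (h : ∀ j < i, e j = e' j) :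
    c.state w s₁ e i = c.state w s₁ e' i := by
  rw [Encoder.state, c.path_congr w s₁ h, Encoder.state]

theorem Encoder.input_congr {e e' : ℕ → Bool} {i : ℕ} (h : ∀ j < i, e j = e' j) :
    c.input w s₁ e i = c.input w s₁ e' i := by
  rw [Encoder.input, c.path_congr w s₁ h, Encoder.input]

theorem Encoder.state_succ (e : ℕ → Bool) (i : ℕ) :
    c.state w s₁ e (i + 1) = nextBattery (c.state w s₁ e i) (c.input w s₁ e i) (e i) := rfl

theorem Encoder.input_eq_false {e : ℕ → Bool} {i : ℕ} (h : c.state w s₁ e i = false) :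
    c.input w s₁ e i = false := by
  rw [Encoder.state] at h
  rw [Encoder.input, h]
  exact c.energy _ _

/-- The number of channel uses with a full battery before time `n`, plus the expected total idle
time caused by the ones sent before time `n`. -/
noncomputable def Encoder.cost (q : ℝ) (n : ℕ) (e : ℕ → Bool) : ℝ :=
  ∑ i ∈ Finset.range n, (((c.state w s₁ e i).toNat : ℝ) +
    (c.input w s₁ e i).toNat * ((1 - q) / q))

theorem Encoder.cost_succ (q : ℝ) (n : ℕ) (e : ℕ → Bool) :
    c.cost w s₁ q (n + 1) e = c.cost w s₁ q n e + (((c.state w s₁ e n).toNat : ℝ) +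
      (c.input w s₁ e n).toNat * ((1 - q) / q)) :=
  Finset.sum_range_succ _ _

/-- The cost, centred so that it is a martingale in the harvests. -/
noncomputable def Encoder.balance (q : ℝ) (n : ℕ) (e : ℕ → Bool) : ℝ :=
  c.cost w s₁ q n e - n + (((c.state w s₁ e n).toNat : ℝ) - s₁.toNat) / q

theorem Encoder.balance_congr (q : ℝ) {n : ℕ} {e e' : ℕ → Bool} (h : ∀ j < n, e j = e' j) :
    c.balance w s₁ q n e = c.balance w s₁ q n e' := by
  have : c.cost w s₁ q n e = c.cost w s₁ q n e' := by
    refine Finset.sum_congr rfl fun i hi => ?_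
    have hi' := Finset.mem_range.1 hi
    rw [c.state_congr w s₁ fun j hj => h j (by omega), c.input_congr w s₁ fun j hj => h j (by omega)]
  rw [balance, balance, this, c.state_congr w s₁ h]

/-- The harvest matters only if the battery is empty after transmission, that is, if state and input
agree. Otherwise the battery stays full and the unit cost cancels the unit of time. -/
theorem Encoder.balance_succ {q : ℝ} (hq : 0 < q) (n : ℕ) (e : ℕ → Bool) :
    c.balance w s₁ q (n + 1) e = c.balance w s₁ q n e +
      (if c.state w s₁ e n = c.input w s₁ e n then 1 else 0) * (((e n).toNat : ℝ) / q - 1) := by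
  have hin := c.input_eq_false w s₁ (e := e) (i := n)
  simp only [balance, c.cost_succ, c.state_succ]
  push_cast
  generalize c.state w s₁ e n = s at *
  generalize c.input w s₁ e n = x at *
  generalize e n = b
  generalize c.cost w s₁ q n e = C
  cases s <;> cases x <;> cases b <;> simp [nextBattery] at hin ⊢ <;> field_simp <;> ring

theorem expect_balance_sq_le {q : unitInterval} (hq : 0 < q) (n : ℕ) :
    expect q n (fun e => c.balance w s₁ q n e ^ 2) ≤ n / (q : ℝ) ^ 2 := by
  have hq0 : 0 < (q : ℝ) := hq
  have hq1 : (q : ℝ) ≤ 1 := q.2.2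
  induction n with
  | zero => simp [expect, Encoder.balance, Encoder.cost, Encoder.state, Encoder.path]
  | succ n ih =>
    rw [expect_succ]
    have key : ∀ e : Fin n → Bool, ∑ b, bernoulliWeight q b *
        c.balance w s₁ q (n + 1) (extend (Fin.snoc e b : Fin (n + 1) → Bool)) ^ 2 ≤
        c.balance w s₁ q n (extend e) ^ 2 + 1 / (q : ℝ) ^ 2 := by
      intro e
      have h : ∀ b : Bool, ∀ j < n,
          extend (Fin.snoc e b : Fin (n + 1) → Bool) j = extend e j :=
        fun b j hj => extend_snoc_lt e b hj
      simp only [c.balance_succ w s₁ hq0, extend_snoc_last, c.balance_congr w s₁ q (h _),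
        c.state_congr w s₁ (h _), c.input_congr w s₁ (h _)]
      set a := c.balance w s₁ q n (extend e)
      have hinv : 1 ≤ 1 / (q : ℝ) ^ 2 := by
        rw [le_div_iff₀ (by positivity)]; nlinarith
      split_ifs
      · simp only [Fintype.sum_bool, bernoulliWeight, if_true, Bool.toNat_true, Bool.toNat_false]
        -- The cross term vanishes; the increment has variance `1 / q - 1`.
        have : (q : ℝ) * (a + 1 * (((1 : ℕ) : ℝ) / q - 1)) ^ 2 +
            (1 - q) * (a + 1 * (((0 : ℕ) : ℝ) / q - 1)) ^ 2 = a ^ 2 + (1 / q - 1) := by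
          push_cast; field_simp; ring
        simp only [Bool.false_eq_true, if_false]
        rw [this]
        have h2 : 1 / (q : ℝ) ≤ 1 / (q : ℝ) ^ 2 := by
          apply one_div_le_one_div_of_le (by positivity); nlinarith
        linarith
      · simp only [zero_mul, add_zero, ← Finset.sum_mul, sum_bernoulliWeight, one_mul]
        linarith
    calc _ ≤ expect q n (fun e => c.balance w s₁ q n e ^ 2 + 1 / (q : ℝ) ^ 2) :=
          Finset.sum_le_sum fun e _ =>
            mul_le_mul_of_nonneg_left (key e) (prod_bernoulliWeight_nonneg q e)
      _ ≤ _ := by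
          rw [expect_add, expect_const]
          push_cast
          rw [add_div]
          linarith

/-- Chebyshev's inequality. -/
theorem expect_balance_large_le {q : unitInterval} (hq : 0 < q) (n : ℕ) {t : ℝ} (ht : 0 < t) :
    expect q n (fun e => if t ≤ |c.balance w s₁ q n e| then 1 else 0) ≤
      n / ((q : ℝ) ^ 2 * t ^ 2) := by
  calc _ ≤ expect q n (fun e => 1 / t ^ 2 * c.balance w s₁ q n e ^ 2) := by
        refine expect_mono q n fun e => ?_
        split_ifs with h
        · rw [← sq_abs (c.balance w s₁ q n e), one_div_mul_eq_div, le_div_iff₀ (by positivity),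
            one_mul]
          gcongr
        · positivity
    _ ≤ 1 / t ^ 2 * (n / (q : ℝ) ^ 2) := by
        rw [expect_mul_left]
        gcongr
        exact expect_balance_sq_le c w s₁ hq n
    _ = _ := by
        rw [one_div_mul_eq_div, div_div]

theorem Encoder.abs_cost_sub_le {q : ℝ} (hq : 0 < q) (n : ℕ) (e : ℕ → Bool) :
    |c.cost w s₁ q n e - n - c.balance w s₁ q n e| ≤ 1 / q := by
  rw [balance, sub_add_cancel_left, abs_neg, abs_div, abs_of_pos hq]
  gcongr
  cases c.state w s₁ e n <;> cases s₁ <;> simp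

end Martingale

/-! ### Converse -/

/-- Battery state driven by given inputs `x` and harvests `e`. -/
def drivenState (s₁ : Bool) (e x : ℕ → Bool) : ℕ → Bool
  | 0 => s₁
  | i + 1 => nextBattery (drivenState s₁ e x i) (x i) (e i)

theorem drivenState_congr (s₁ : Bool) (e : ℕ → Bool) {x x' : ℕ → Bool} {i : ℕ}
    (h : ∀ j < i, x j = x' j) : drivenState s₁ e x i = drivenState s₁ e x' i := by
  induction i with
  | zero => rfl
  | succ i ih => rw [drivenState, drivenState, ih fun j hj => h j (by omega), h i (by omega)]

theorem Encoder.state_eq_drivenState {M : ℕ} (c : Encoder M) (w : Fin M) (s₁ : Bool)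
    (e : ℕ → Bool) (i : ℕ) : c.state w s₁ e i = drivenState s₁ e (c.input w s₁ e) i := by
  induction i with
  | zero => rfl
  | succ i ih => rw [c.state_succ, ih, drivenState]

/-- Input law of the memoryless policy that sends a one with probability `exp (-(a / q))` whenever
the battery is full. -/
noncomputable def policy (a q : ℝ) : Bool → Bool → ℝ
  | true, true => exp (-(a / q))
  | true, false => exp (-a)
  | false, true => 0
  | false, false => 1

theorem policy_nonneg (a q : ℝ) (s x : Bool) : 0 ≤ policy a q s x := by
  cases s <;> cases x <;> simp [policy, (exp_pos _).le]

theorem sum_policy {a q : ℝ} (h : exp (-a) + exp (-(a / q)) = 1) (s : Bool) :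
    ∑ x, policy a q s x = 1 := by
  cases s
  · simp [policy]
  · simpa [policy, add_comm] using h

/-- The last input is summed out first, since no earlier factor depends on it. -/
theorem sum_prod_policy {a q : ℝ} (h : exp (-a) + exp (-(a / q)) = 1) (s₁ : Bool) (e : ℕ → Bool)
    (n : ℕ) : ∑ x : Fin n → Bool, ∏ i ∈ Finset.range n,
      policy a q (drivenState s₁ e (extend x) i) (extend x i) = 1 := by
  induction n with
  | zero => simp
  | succ n ih =>
    rw [sum_fin_succ_bool, ← ih]
    refine Finset.sum_congr rfl fun x _ => ?_
    simp_rw [Finset.prod_range_succ, extend_snoc_last,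
      drivenState_congr s₁ e (i := n) fun j hj => extend_snoc_lt x _ hj]
    have : ∀ b : Bool, ∏ i ∈ Finset.range n,
        policy a q (drivenState s₁ e (extend (Fin.snoc x b : Fin (n + 1) → Bool)) i)
          (extend (Fin.snoc x b : Fin (n + 1) → Bool) i) =
        ∏ i ∈ Finset.range n, policy a q (drivenState s₁ e (extend x) i) (extend x i) := by
      intro b
      refine Finset.prod_congr rfl fun i hi => ?_
      have hi' := Finset.mem_range.1 hi
      rw [extend_snoc_lt x b hi',
        drivenState_congr s₁ e (i := i) fun j hj => extend_snoc_lt x b (by omega)]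
    simp_rw [this, ← Finset.mul_sum, sum_policy h, mul_one]

/-- The policy is tuned so that log-likelihood is proportional to cost: an empty use is free, a zero
on a full battery costs `a`, a one costs `a * (1 + (1 - q) / q) = a / q`. -/
theorem Encoder.prod_policy_eq {M : ℕ} (c : Encoder M) (w : Fin M) (s₁ : Bool) (e : ℕ → Bool)
    {a q : ℝ} (hq : 0 < q) (n : ℕ) :
    ∏ i ∈ Finset.range n, policy a q (c.state w s₁ e i) (c.input w s₁ e i) =
      exp (-(a * c.cost w s₁ q n e)) := by
  rw [cost, Finset.mul_sum, ← Finset.sum_neg_distrib, exp_sum]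
  refine Finset.prod_congr rfl fun i _ => ?_
  have hin := c.input_eq_false w s₁ (e := e) (i := i)
  generalize c.state w s₁ e i = s at *
  generalize c.input w s₁ e i = x at *
  cases s <;> cases x <;> simp [policy] at hin ⊢
  field_simp
  ring

/-- For fixed harvests, the correctly decoded messages have distinct input sequences. -/
theorem sum_correct_le {q : ℝ} (hq : 0 < q) {a : ℝ} (h : exp (-a) + exp (-(a / q)) = 1)
    {n M : ℕ} (D : Observation) (c : Encoder M) (dec : D.Obs n → Fin M) (s₁ : Bool)
    (e : ℕ → Bool) :
    ∑ w : Fin M, (if dec (D.obs n (fun i => c.input w s₁ e i)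
        (fun i => c.state w s₁ e i)) = w then exp (-(a * c.cost w s₁ q n e)) else 0) ≤ 1 := by
  classical
  rw [← Finset.sum_filter]
  set A := Finset.univ.filter fun w : Fin M => dec (D.obs n (fun i => c.input w s₁ e i)
        (fun i => c.state w s₁ e i)) = w with hA
  let φ : Fin M → Fin n → Bool := fun w i => c.input w s₁ e i
  have hext : ∀ w, ∀ j < n, extend (φ w) j = c.input w s₁ e j := by
    intro w j hj
    simp [extend, φ, hj]
  have hdriven : ∀ w, ∀ i ≤ n, drivenState s₁ e (extend (φ w)) i = c.state w s₁ e i := by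
    intro w i hi
    rw [c.state_eq_drivenState]
    exact drivenState_congr s₁ e fun j hj => hext w j (by omega)
  -- With `s₁` and `e` fixed, the inputs determine the states and hence all that any `Observation`
  -- can show.
  have hinj : Set.InjOn φ A := by
    intro w hw w' hw' hww
    have h1 : dec (D.obs n (fun i => c.input w s₁ e i) (fun i => c.state w s₁ e i)) = w := by
      simpa [hA] using hw
    have h2 : dec (D.obs n (fun i => c.input w' s₁ e i) (fun i => c.state w' s₁ e i)) = w' := by
      simpa [hA] using hw'
    have h3 : (fun i : Fin n => c.input w s₁ e i) = fun i : Fin n => c.input w' s₁ e i := hww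
    have h4 : (fun i : Fin n => c.state w s₁ e i) = fun i : Fin n => c.state w' s₁ e i := by
      funext i
      rw [← hdriven w i i.2.le, ← hdriven w' i i.2.le, hww]
    rw [← h1, ← h2, h3, h4]
  have hsum : ∀ w, exp (-(a * c.cost w s₁ q n e)) = ∏ i ∈ Finset.range n,
      policy a q (drivenState s₁ e (extend (φ w)) i) (extend (φ w) i) := by
    intro w
    rw [← c.prod_policy_eq w s₁ e hq n]
    refine Finset.prod_congr rfl fun i hi => ?_
    have hi' := Finset.mem_range.1 hi
    rw [hext w i hi', hdriven w i hi'.le]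
  calc _ = ∑ x ∈ A.image φ, ∏ i ∈ Finset.range n,
        policy a q (drivenState s₁ e (extend x) i) (extend x i) := by
        rw [Finset.sum_image hinj]
        exact Finset.sum_congr rfl fun w _ => hsum w
    _ ≤ ∑ x : Fin n → Bool, ∏ i ∈ Finset.range n,
        policy a q (drivenState s₁ e (extend x) i) (extend x i) :=
        Finset.sum_le_sum_of_subset_of_nonneg (Finset.subset_univ _) fun _ _ _ =>
          Finset.prod_nonneg fun _ _ => policy_nonneg _ _ _ _
    _ = 1 := sum_prod_policy h s₁ e n

/-- Each outcome is a decoding error, a large deviation of the balance, or a correct decoding at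
cost at most `n + 1 / q + t`. In the last case its policy weight is at least the inverse of the
exponential factor. -/
theorem one_sub_errorProb_le {q r : unitInterval} (hq : 0 < q) {a : ℝ} (ha : 0 < a)
    (h : exp (-a) + exp (-(a / q)) = 1) {n M : ℕ} (hM : 0 < M) (D : Observation)
    (c : Encoder M) (dec : D.Obs n → Fin M) {t : ℝ} (ht : 0 < t) :
    1 - errorProb q r D c dec ≤
      n / ((q : ℝ) ^ 2 * t ^ 2) + exp (a * (n + 1 / q + t)) / M := by
  have hq0 : 0 < (q : ℝ) := hq
  have hM0 : (0 : ℝ) < M := by exact_mod_cast hM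
  set B : ℝ := n / ((q : ℝ) ^ 2 * t ^ 2) with hB
  set K : ℝ := exp (a * (n + 1 / q + t)) with hK
  let bad : Fin M → Bool → (ℕ → Bool) → ℝ := fun w s₁ e =>
    if dec (D.obs n (fun i => c.input w s₁ e i) (fun i => c.state w s₁ e i)) = w then 0 else 1
  let good : Fin M → Bool → (ℕ → Bool) → ℝ := fun w s₁ e =>
    if dec (D.obs n (fun i => c.input w s₁ e i) (fun i => c.state w s₁ e i)) = w
      then exp (-(a * c.cost w s₁ q n e)) else 0
  have hpt : ∀ w s₁ e, 1 ≤ bad w s₁ e +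
      ((if t ≤ |c.balance w s₁ q n e| then 1 else 0) + K * good w s₁ e) := by
    intro w s₁ e
    simp only [bad, good]
    split_ifs with h1 h2 h2
    · have : 0 ≤ K * exp (-(a * c.cost w s₁ q n e)) := by positivity
      linarith
    · rw [zero_add, zero_add, hK, ← exp_add, one_le_exp_iff]
      have := abs_le.1 (c.abs_cost_sub_le w s₁ hq0 n e)
      have h3 := abs_lt.1 (not_le.1 h2)
      have : c.cost w s₁ q n e ≤ n + 1 / q + t := by linarith
      nlinarith
    · norm_num
    · norm_num
  have hs : ∀ s₁, (M : ℝ) ≤ ∑ w, expect q n (bad w s₁) + (M * B + K) := by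
    intro s₁
    calc (M : ℝ) = ∑ _w : Fin M, expect q n (fun _ => 1) := by simp [expect_const]
      _ ≤ ∑ w, (expect q n (bad w s₁) + (B + K * expect q n (good w s₁))) := by
        refine Finset.sum_le_sum fun w _ => (expect_mono q n (hpt w s₁)).trans ?_
        rw [expect_add, expect_add, expect_mul_left]
        gcongr
        exact expect_balance_large_le c w s₁ hq n ht
      _ ≤ _ := by
        rw [Finset.sum_add_distrib, Finset.sum_add_distrib, ← Finset.mul_sum]
        simp only [Finset.sum_const, Finset.card_univ, Fintype.card_fin, nsmul_eq_mul]
        have h1 : ∑ w, expect q n (good w s₁) ≤ 1 := by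
          rw [expect_sum, ← expect_const q n 1]
          exact expect_mono q n fun e => sum_correct_le hq0 h D c dec s₁ e
        have : K * ∑ w, expect q n (good w s₁) ≤ K :=
          mul_le_of_le_one_right (exp_pos _).le h1
        linarith
  have herr : M * errorProb q r D c dec =
      ∑ s₁, bernoulliWeight r s₁ * ∑ w, expect q n (bad w s₁) := by
    rw [errorProb_eq, ← mul_assoc, mul_one_div_cancel hM0.ne', one_mul, Finset.sum_comm]
    simp_rw [← Finset.mul_sum]
    rfl
  have htot : (M : ℝ) ≤ M * errorProb q r D c dec + (M * B + K) := by
    calc (M : ℝ) = ∑ s₁, bernoulliWeight r s₁ * M := by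
          rw [← Finset.sum_mul, sum_bernoulliWeight, one_mul]
      _ ≤ ∑ s₁, bernoulliWeight r s₁ * (∑ w, expect q n (bad w s₁) + (M * B + K)) :=
          Finset.sum_le_sum fun s₁ _ =>
            mul_le_mul_of_nonneg_left (hs s₁) (bernoulliWeight_nonneg r s₁)
      _ = _ := by
          simp_rw [mul_add, Finset.sum_add_distrib, ← Finset.sum_mul, sum_bernoulliWeight, herr]
          ring
  have : 1 - errorProb q r D c dec - B ≤ K / M := by
    rw [le_div_iff₀ hM0]
    linarith
  linarith

theorem IsAchievable.le {q r : unitInterval} (hq : 0 < q) {a : ℝ} (ha : 0 < a)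
    (h : exp (-a) + exp (-(a / q)) = 1) {D : Observation} {R : ℝ≥0}
    (hR : IsAchievable q r D R) : (R : ℝ) ≤ a / log 2 := by
  have hq0 : 0 < (q : ℝ) := hq
  have hlog : (0 : ℝ) < log 2 := log_pos (by norm_num)
  by_contra! hlt
  rw [div_lt_iff₀ hlog] at hlt
  obtain ⟨δ, hδ, hδR⟩ : ∃ δ : ℝ, 0 < δ ∧ a * (1 + δ) < R * log 2 := by
    -- This makes `a * (1 + δ)` the midpoint of `a` and `R * log 2`; the deviation allowed below is
    -- `t = δ * n`.
    refine ⟨(R * log 2 - a) / (2 * a), by apply div_pos <;> linarith, ?_⟩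
    rw [mul_add, mul_one]
    have : a * ((R * log 2 - a) / (2 * a)) = (R * log 2 - a) / 2 := by field_simp
    linarith
  have h1 : Filter.Tendsto (fun n : ℕ => 1 / ((q : ℝ) ^ 2 * δ ^ 2) * (1 / (n : ℝ)) +
      exp (a / q) * exp (-(R * log 2 - a * (1 + δ)) * n)) Filter.atTop (nhds 0) := by
    have h2 := (tendsto_one_div_atTop_nhds_zero_nat (𝕜 := ℝ)).const_mul (1 / ((q : ℝ) ^ 2 * δ ^ 2))
    have h3 : Filter.Tendsto (fun n : ℕ => exp (-(R * log 2 - a * (1 + δ)) * n))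
        Filter.atTop (nhds 0) :=
      tendsto_exp_atBot.comp
        (tendsto_natCast_atTop_atTop.const_mul_atTop_of_neg (by linarith))
    simpa using h2.add (h3.const_mul (exp (a / q)))
  obtain ⟨N, hN⟩ := hR (1 / 4) (by norm_num)
  obtain ⟨n, hn1, hn2, hn3⟩ := ((h1.eventually (gt_mem_nhds (show (0 : ℝ) < 1 / 4 by norm_num))).and
    ((Filter.eventually_ge_atTop N).and (Filter.eventually_ge_atTop 1))).exists
  obtain ⟨M, c, dec, hM, herr⟩ := hN n hn2
  have hn0 : (0 : ℝ) < n := by exact_mod_cast hn3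
  have hpow : (2 : ℝ) ^ ((n : ℝ) * (R : ℝ)) = exp (n * R * log 2) := by
    rw [rpow_def_of_pos (by norm_num)]; ring_nf
  rw [hpow] at hM
  have hM0 : 0 < M := by
    have := (exp_pos _).trans_le hM
    exact_mod_cast this
  have hconv := one_sub_errorProb_le (r := r) hq ha h hM0 D c dec (t := δ * n) (by positivity)
  have h4 : exp (a * (n + 1 / q + δ * n)) / M ≤
      exp (a / q) * exp (-(R * log 2 - a * (1 + δ)) * n) := by
    rw [div_le_iff₀ (by exact_mod_cast hM0)]
    calc exp (a * (n + 1 / q + δ * n))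
        = exp (a / q) * exp (-(R * log 2 - a * (1 + δ)) * n) * exp (n * R * log 2) := by
          rw [← exp_add, ← exp_add]; ring_nf
      _ ≤ _ := by gcongr
  have h5 : (n : ℝ) / ((q : ℝ) ^ 2 * (δ * n) ^ 2) = 1 / ((q : ℝ) ^ 2 * δ ^ 2) * (1 / (n : ℝ)) := by
    field_simp
  linarith

/-! ### Idle times determine the battery states -/

section Idle

variable {n : ℕ}

/-- The number of ones before position `i`. -/
def onesBefore (y : Fin n → Bool) (i : Fin n) : ℕ :=
  (Finset.univ.filter fun j : Fin n => j < i ∧ y j = true).card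

theorem eq_false_of_onesBefore_eq {y : Fin n → Bool} {i j l : Fin n}
    (h : onesBefore y i = onesBefore y j) (hil : i ≤ l) (hlj : l < j) : y l = false := by
  by_contra hl
  rw [Bool.not_eq_false] at hl
  refine absurd h (Nat.ne_of_lt (Finset.card_lt_card ?_))
  refine (Finset.ssubset_iff_of_subset fun x hx => ?_).2 ⟨l, ?_, ?_⟩
  · simp only [Finset.mem_filter, Finset.mem_univ, true_and] at hx ⊢
    exact ⟨hx.1.trans (hil.trans_lt hlj), hx.2⟩
  · simp [hlj, hl]
  · simp [not_lt.2 hil]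

/-- By `hs` a full battery stays full until a one is sent, so the empty uses open each gap between
ones. A use is therefore empty exactly when its rank in its gap is below the idle time. The one that
ends a gap belongs to it. -/
theorem eq_false_iff_lt_idleTime {y s : Fin n → Bool}
    (hs : ∀ i j, i ≤ j → (∀ l, i ≤ l → l < j → y l = false) → s i = true → s j = true)
    (i : Fin n) : s i = false ↔
      (Finset.univ.filter fun j : Fin n => j < i ∧ onesBefore y j = onesBefore y i).card <
        idleTime y s (onesBefore y i) := by
  constructor
  · intro hi
    refine Finset.card_lt_card ((Finset.ssubset_iff_of_subset fun j hj => ?_).2 ⟨i, ?_, ?_⟩)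
    · simp only [Finset.mem_filter, Finset.mem_univ, true_and] at hj ⊢
      refine ⟨?_, hj.2⟩
      by_contra hsj
      rw [Bool.not_eq_false] at hsj
      have := hs j i hj.1.le (fun l h1 h2 => eq_false_of_onesBefore_eq hj.2 h1 h2) hsj
      simp [hi] at this
    · simp only [Finset.mem_filter, Finset.mem_univ, true_and]
      exact ⟨hi, rfl⟩
    · simp
  · intro hlt
    by_contra hi
    rw [Bool.not_eq_false] at hi
    refine absurd hlt (not_lt.2 (Finset.card_le_card fun j hj => ?_))
    simp only [Finset.mem_filter, Finset.mem_univ, true_and] at hj ⊢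
    refine ⟨?_, hj.2⟩
    by_contra hij
    have := hs i j (not_lt.1 hij)
      (fun l h1 h2 => eq_false_of_onesBefore_eq (Eq.symm hj.2) h1 h2) hi
    simp [hj.1] at this

theorem states_eq_of_idleTime_eq {y s s' : Fin n → Bool}
    (hs : ∀ i j, i ≤ j → (∀ l, i ≤ l → l < j → y l = false) → s i = true → s j = true)
    (hs' : ∀ i j, i ≤ j → (∀ l, i ≤ l → l < j → y l = false) → s' i = true → s' j = true)
    (h : idleTime y s = idleTime y s') : s = s' := by
  funext i
  have h1 := eq_false_iff_lt_idleTime hs i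
  rw [h, ← eq_false_iff_lt_idleTime hs' i] at h1
  cases hi : s i <;> cases hi' : s' i <;> simp_all

end Idle

theorem Encoder.state_stays_full {M : ℕ} (c : Encoder M) (w : Fin M) (s₁ : Bool) (e : ℕ → Bool)
    {i j : ℕ} (hij : i ≤ j) (hx : ∀ l, i ≤ l → l < j → c.input w s₁ e l = false)
    (hi : c.state w s₁ e i = true) : c.state w s₁ e j = true := by
  induction j, hij using Nat.le_induction with
  | base => exact hi
  | succ j hij ih =>
    rw [c.state_succ, ih fun l h1 h2 => hx l h1 (by omega), hx j hij (by omega)]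
    simp [nextBattery]

/-! ### Achievability -/

/-- Whenever the battery is full, send the next bit of the codeword. -/
def bitEncoder {M : ℕ} (b : Fin M → ℕ → Bool) : Encoder M where
  enc w past s := s && b w (past.count true)
  energy _ _ := rfl

section BitEncoder

variable {M : ℕ} (b : Fin M → ℕ → Bool) (w : Fin M) (s₁ : Bool) (e : ℕ → Bool)

/-- The number of channel uses with a full battery before time `n`. -/
def numFull (n : ℕ) : ℕ := ((bitEncoder b).path w s₁ e n).1.count true

theorem numFull_zero : numFull b w s₁ e 0 = 0 := rfl

theorem numFull_succ (n : ℕ) : numFull b w s₁ e (n + 1) =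
    numFull b w s₁ e n + ((bitEncoder b).state w s₁ e n).toNat := by
  rw [numFull, Encoder.path, numFull, Encoder.state, List.count_cons]
  cases ((bitEncoder b).path w s₁ e n).2 <;> simp

theorem input_bitEncoder (n : ℕ) : (bitEncoder b).input w s₁ e n =
    ((bitEncoder b).state w s₁ e n && b w (numFull b w s₁ e n)) := rfl

theorem cost_bitEncoder (q : ℝ) (n : ℕ) : (bitEncoder b).cost w s₁ q n e =
    numFull b w s₁ e n +
      ((∑ j ∈ Finset.range (numFull b w s₁ e n), (b w j).toNat : ℕ) : ℝ) * ((1 - q) / q) := by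
  induction n with
  | zero => simp [Encoder.cost, numFull_zero]
  | succ n ih =>
    rw [Encoder.cost_succ, ih, numFull_succ, input_bitEncoder]
    cases (bitEncoder b).state w s₁ e n
    · simp
    · rw [Bool.toNat_true, Finset.sum_range_succ, Bool.true_and]
      push_cast
      ring

theorem exists_numFull_eq {n j : ℕ} (h : j < numFull b w s₁ e n) :
    ∃ i < n, (bitEncoder b).state w s₁ e i = true ∧ numFull b w s₁ e i = j := by
  induction n with
  | zero => simp [numFull_zero] at h
  | succ n ih =>
    by_cases hj : j < numFull b w s₁ e n
    · obtain ⟨i, hi, h'⟩ := ih hj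
      exact ⟨i, by omega, h'⟩
    · rw [numFull_succ] at h
      cases hs : (bitEncoder b).state w s₁ e n
      · rw [hs, Bool.toNat_false] at h
        omega
      · rw [hs, Bool.toNat_true] at h
        exact ⟨n, by omega, hs, by omega⟩

/-- Equal observations force equal states, hence equal bit counters, so both runs send their `j`-th
bit in the same channel use. Only the first run need be assumed to send `m` bits. -/
theorem codeword_eq_of_obs_eq {n m : ℕ} {w w' : Fin M} {s₁ s₁' : Bool} {e e' : ℕ → Bool}
    (hm : m ≤ numFull b w s₁ e n)
    (h : outputAndIdleTimes.obs n (fun i => (bitEncoder b).input w s₁ e i)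
        (fun i => (bitEncoder b).state w s₁ e i) =
      outputAndIdleTimes.obs n (fun i => (bitEncoder b).input w' s₁' e' i)
        (fun i => (bitEncoder b).state w' s₁' e' i)) {j : ℕ} (hj : j < m) : b w j = b w' j := by
  have hy : (fun i : Fin n => (bitEncoder b).input w s₁ e i) =
      fun i : Fin n => (bitEncoder b).input w' s₁' e' i := congrArg Prod.fst h
  have hz : idleTime (fun i : Fin n => (bitEncoder b).input w s₁ e i)
        (fun i => (bitEncoder b).state w s₁ e i) =
      idleTime (fun i : Fin n => (bitEncoder b).input w' s₁' e' i)
        (fun i => (bitEncoder b).state w' s₁' e' i) := congrArg Prod.snd h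
  rw [← hy] at hz
  have hst := states_eq_of_idleTime_eq
    (fun i j hij hx hi => (bitEncoder b).state_stays_full w s₁ e (i := i) (j := j) hij
      (fun l h1 h2 => hx ⟨l, by omega⟩ h1 h2) hi)
    (fun i j hij hx hi => (bitEncoder b).state_stays_full w' s₁' e' (i := i) (j := j) hij
      (fun l h1 h2 => (congrFun hy ⟨l, by omega⟩).symm.trans (hx ⟨l, by omega⟩ h1 h2)) hi) hz
  have hfull : ∀ i ≤ n, numFull b w s₁ e i = numFull b w' s₁' e' i := by
    intro i
    induction i with
    | zero => intro _; rfl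
    | succ i ih =>
      intro hi
      have := congrFun hst ⟨i, hi⟩
      simp only at this
      rw [numFull_succ, numFull_succ, ih (by omega), this]
  obtain ⟨i, hi, hs, hij⟩ := exists_numFull_eq b w s₁ e (hj.trans_le hm)
  have h1 := congrFun hy ⟨i, hi⟩
  have h2 := congrFun hst ⟨i, hi⟩
  simp only at h1 h2
  rw [input_bitEncoder, input_bitEncoder, ← h2, hs, ← hfull i hi.le, hij] at h1
  simpa using h1

end BitEncoder

/-- Codewords of length `m` with `k` ones are decoded reliably if the block is long enough for the
expected duration of a codeword. -/
theorem exists_bit_code {q : unitInterval} (r : unitInterval) (hq : 0 < q) {n m k : ℕ}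
    (hk : k ≤ m) {t : ℝ} (ht : 0 < t)
    (hn : m + k * ((1 - (q : ℝ)) / q) + 1 / q + t ≤ n) :
    ∃ (c : Encoder (m.choose k)) (dec : outputAndIdleTimes.Obs n → Fin (m.choose k)),
      errorProb q r outputAndIdleTimes c dec ≤ n / ((q : ℝ) ^ 2 * t ^ 2) := by
  classical
  have hq0 : 0 < (q : ℝ) := hq
  have hq1 : 0 ≤ 1 - (q : ℝ) := sub_nonneg.2 q.2.2
  have hM : 0 < m.choose k := Nat.choose_pos hk
  let E : (Finset.powersetCard k (Finset.range m)) ≃ Fin (m.choose k) :=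
    Finset.equivFinOfCardEq (by simp)
  -- Messages are the `k`-subsets of the first `m` positions. Bits beyond `m` are zero, so no run
  -- sends more than `k` ones.
  let b : Fin (m.choose k) → ℕ → Bool := fun w j => decide (j ∈ (E.symm w : Finset ℕ))
  have hmem : ∀ w, (E.symm w : Finset ℕ) ⊆ Finset.range m ∧ (E.symm w : Finset ℕ).card = k :=
    fun w => Finset.mem_powersetCard.1 (E.symm w).2
  have hb : ∀ w w', (∀ j < m, b w j = b w' j) → w = w' := by
    intro w w' h
    refine E.symm.injective (Subtype.ext (Finset.ext fun j => ?_))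
    by_cases hj : j < m
    · simpa [b] using h j hj
    · exact iff_of_false (fun h' => hj (Finset.mem_range.1 ((hmem w).1 h')))
        fun h' => hj (Finset.mem_range.1 ((hmem w').1 h'))
  have hones : ∀ w l, ∑ j ∈ Finset.range l, (b w j).toNat ≤ k := by
    intro w l
    rw [← (hmem w).2]
    calc ∑ j ∈ Finset.range l, (b w j).toNat
        = ((Finset.range l).filter fun j => j ∈ (E.symm w : Finset ℕ)).card := by
          rw [Finset.card_filter]
          refine Finset.sum_congr rfl fun j _ => ?_
          simp only [b]
          split_ifs with h <;> simp [h]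
      _ ≤ _ := Finset.card_le_card fun j hj => (Finset.mem_filter.1 hj).2
  let dec : outputAndIdleTimes.Obs n → Fin (m.choose k) := fun o =>
    if h : ∃ w s₁ e, m ≤ numFull b w s₁ e n ∧
        outputAndIdleTimes.obs n (fun i => (bitEncoder b).input w s₁ e i)
          (fun i => (bitEncoder b).state w s₁ e i) = o
    then h.choose else ⟨0, hM⟩
  have hdec : ∀ w s₁ e, m ≤ numFull b w s₁ e n →
      dec (outputAndIdleTimes.obs n (fun i => (bitEncoder b).input w s₁ e i)
        (fun i => (bitEncoder b).state w s₁ e i)) = w := by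
    intro w s₁ e hw
    have hex : ∃ w' s₁' e', m ≤ numFull b w' s₁' e' n ∧
        outputAndIdleTimes.obs n (fun i => (bitEncoder b).input w' s₁' e' i)
          (fun i => (bitEncoder b).state w' s₁' e' i) =
        outputAndIdleTimes.obs n (fun i => (bitEncoder b).input w s₁ e i)
          (fun i => (bitEncoder b).state w s₁ e i) := ⟨w, s₁, e, hw, rfl⟩
    simp only [dec, dif_pos hex]
    obtain ⟨s₁', e', hw', heq⟩ := hex.choose_spec
    exact hb _ _ fun j hj => codeword_eq_of_obs_eq b hw' heq hj
  -- With too few full uses the cost is at most `m + k * ((1 - q) / q)`, which `hn` places `1 / q +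
  -- t` below `n`; the balance is then at most `-t`.
  have hbad : ∀ w s₁ e, ¬ m ≤ numFull b w s₁ e n →
      t ≤ |(bitEncoder b).balance w s₁ q n e| := by
    intro w s₁ e hw
    have h1 := abs_le.1 ((bitEncoder b).abs_cost_sub_le w s₁ hq0 n e)
    have h2 := cost_bitEncoder b w s₁ e q n
    have h3 : (numFull b w s₁ e n : ℝ) ≤ m := by exact_mod_cast (not_le.1 hw).le
    have h4 : ((∑ j ∈ Finset.range (numFull b w s₁ e n), (b w j).toNat : ℕ) : ℝ) ≤ k := by
      exact_mod_cast hones w _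
    have h5 := mul_le_mul_of_nonneg_right h4 (div_nonneg hq1 hq0.le)
    rw [le_abs]
    right
    linarith
  refine ⟨bitEncoder b, dec, ?_⟩
  have hterm : ∀ w s₁, expect q n (fun e => if dec (outputAndIdleTimes.obs n
      (fun i => (bitEncoder b).input w s₁ e i) (fun i => (bitEncoder b).state w s₁ e i)) = w
      then 0 else 1) ≤ n / ((q : ℝ) ^ 2 * t ^ 2) := by
    intro w s₁
    refine (expect_mono q n fun e => ?_).trans
      (expect_balance_large_le (bitEncoder b) w s₁ hq n ht)
    by_cases hw : m ≤ numFull b w s₁ e n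
    · rw [if_pos (hdec w s₁ e hw)]
      positivity
    · rw [if_pos (hbad w s₁ e hw)]
      split_ifs <;> norm_num
  have hM0 : (0 : ℝ) < (m.choose k : ℕ) := by exact_mod_cast hM
  rw [errorProb_eq, one_div_mul_eq_div, div_le_iff₀ hM0]
  calc _ ≤ ∑ w : Fin (m.choose k), ∑ s₁, bernoulliWeight r s₁ * (n / ((q : ℝ) ^ 2 * t ^ 2)) :=
        Finset.sum_le_sum fun w _ => Finset.sum_le_sum fun s₁ _ =>
          mul_le_mul_of_nonneg_left (hterm w s₁) (bernoulliWeight_nonneg r s₁)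
    _ = _ := by
        simp_rw [← Finset.sum_mul, sum_bernoulliWeight]
        simp [mul_comm]

/-! ### Size of constant-weight codebooks and choice of their parameters -/

theorem exists_choose_ge {a q : ℝ} (hq : 0 < q) (h : exp (-a) + exp (-(a / q)) = 1) (m : ℕ) :
    ∃ k ≤ m, exp (a * (m + k * ((1 - q) / q))) ≤ (m + 1) * (m.choose k : ℝ) := by
  have hsum := add_pow (exp (-(a / q))) (exp (-a)) m
  rw [add_comm, h, one_pow] at hsum
  -- The binomial expansion of `1 = (exp (-(a / q)) + exp (-a)) ^ m` has `m + 1` terms, so some term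
  -- is at least `1 / (m + 1)`.
  have hle : ∑ _k ∈ Finset.range (m + 1), 1 / ((m : ℝ) + 1) ≤
      ∑ k ∈ Finset.range (m + 1), exp (-(a / q)) ^ k * exp (-a) ^ (m - k) * (m.choose k : ℝ) := by
    rw [← hsum, Finset.sum_const, Finset.card_range, nsmul_eq_mul]
    push_cast
    rw [mul_one_div_cancel (by positivity)]
  obtain ⟨k, hk, hle⟩ := Finset.exists_le_of_sum_le (by simp) hle
  have hkm : k ≤ m := Nat.lt_succ_iff.1 (Finset.mem_range.1 hk)
  refine ⟨k, hkm, ?_⟩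
  have hexp : exp (-(a / q)) ^ k * exp (-a) ^ (m - k) =
      (exp (a * (m + k * ((1 - q) / q))))⁻¹ := by
    rw [← exp_nat_mul, ← exp_nat_mul, ← exp_add, ← exp_neg, Nat.cast_sub hkm]
    congr 1
    field_simp
    ring
  rw [hexp, div_le_iff₀ (by positivity)] at hle
  have hpos := exp_pos (a * (m + k * ((1 - q) / q)))
  have := mul_le_mul_of_nonneg_left hle hpos.le
  rw [mul_one] at this
  refine this.trans_eq ?_
  field_simp

/-- Concatenating `J` words of length `m` and weight `k` yields a word of length `J * m` and weight
`J * k`; formally, one term of Vandermonde's identity. -/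
theorem choose_pow_le_choose (m k J : ℕ) : m.choose k ^ J ≤ (J * m).choose (J * k) := by
  induction J with
  | zero => simp
  | succ J ih =>
    rw [pow_succ, Nat.succ_mul, Nat.succ_mul, Nat.add_choose_eq]
    refine (Nat.mul_le_mul_right _ ih).trans ?_
    exact Finset.single_le_sum (f := fun ij : ℕ × ℕ => (J * m).choose ij.1 * m.choose ij.2)
      (fun _ _ => Nat.zero_le _) (a := (J * k, k)) (by simp)

theorem isAchievable_of_lt {q : unitInterval} (r : unitInterval) (hq : 0 < q) {a : ℝ} (ha : 0 < a)
    (h : exp (-a) + exp (-(a / q)) = 1) {R : ℝ≥0} (hR : (R : ℝ) < a / log 2) :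
    IsAchievable q r outputAndIdleTimes R := by
  have hq0 : 0 < (q : ℝ) := hq
  have hq1 : 0 ≤ 1 - (q : ℝ) := sub_nonneg.2 q.2.2
  have hlog : (0 : ℝ) < log 2 := log_pos (by norm_num)
  rw [lt_div_iff₀ hlog] at hR
  have hρ0 : 0 ≤ (R : ℝ) * log 2 := by positivity
  set ρ : ℝ := R * log 2 with hρ
  -- The gap `a - ρ` is split in three: one `η` pays for the factor `m + 1` in the word count, one
  -- (`δ * a = η`) for the fraction `δ` of the block held in reserve, one remains as slack.
  set η : ℝ := (a - ρ) / 3 with hη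
  set δ : ℝ := (a - ρ) / (3 * a) with hδ
  have hη0 : 0 < η := by rw [hη]; linarith
  have hδ0 : 0 < δ := div_pos (by linarith) (by linarith)
  have hδa : δ * a = η := by rw [hδ, hη]; field_simp
  have hgap : ρ < (1 - δ) * (a - η) := by
    have : 0 < δ * η := by positivity
    have : 3 * η = a - ρ := by rw [hη]; ring
    nlinarith
  have hηa : 0 < a - η := by rw [hη]; linarith
  obtain ⟨m, hm1, hmlog⟩ : ∃ m : ℕ, 1 ≤ m ∧ log (m + 1) ≤ η * m := by
    have h1 := (isLittleO_log_id_atTop.def (half_pos hη0))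
    have h2 := (tendsto_natCast_atTop_atTop (R := ℝ)).atTop_add (tendsto_const_nhds (x := (1 : ℝ)))
    obtain ⟨m, hm, hm1⟩ := ((h2.eventually h1).and (Filter.eventually_ge_atTop 1)).exists
    refine ⟨m, hm1, ?_⟩
    have hm1' : (1 : ℝ) ≤ m := by exact_mod_cast hm1
    simp only [id, norm_eq_abs] at hm
    rw [abs_of_pos (show (0 : ℝ) < m + 1 by linarith)] at hm
    have := (le_abs_self _).trans hm
    nlinarith
  obtain ⟨k, hkm, hk⟩ := exists_choose_ge hq0 h m
  set κ : ℝ := m + k * ((1 - (q : ℝ)) / q) with hκ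
  have hm1' : (1 : ℝ) ≤ m := by exact_mod_cast hm1
  have hκm : (m : ℝ) ≤ κ := by
    have : 0 ≤ k * ((1 - (q : ℝ)) / q) := by positivity
    linarith
  have hκ0 : 0 < κ := by linarith
  have hchoose : exp (κ * (a - η)) ≤ (m.choose k : ℝ) := by
    have h1 : exp (a * κ) ≤ exp (η * κ) * (m.choose k : ℝ) := by
      refine hk.trans ?_
      gcongr
      rw [← exp_log (show (0 : ℝ) < m + 1 by linarith)]
      gcongr
      nlinarith
    rw [show κ * (a - η) = a * κ - η * κ by ring, exp_sub, div_le_iff₀ (exp_pos _)]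
    linarith
  intro ε hε
  -- In order: the rounding in `J` loses at most one inner word; half the reserve `δ * n` absorbs `1
  -- / q`; the other half is the deviation `t`, whose Chebyshev bound falls below `ε`.
  have hev : ∀ᶠ n : ℕ in Filter.atTop, κ * (a - η) ≤ ((1 - δ) * (a - η) - ρ) * n ∧
      1 / (q : ℝ) ≤ δ / 2 * n ∧ 4 / ((q : ℝ) ^ 2 * δ ^ 2) ≤ ε * n ∧ 1 ≤ n := by
    have hlin : ∀ x y : ℝ, 0 < x → ∀ᶠ n : ℕ in Filter.atTop, y ≤ x * n := fun x y hx =>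
      (tendsto_natCast_atTop_atTop.const_mul_atTop hx).eventually_ge_atTop y
    exact (hlin _ _ (by linarith)).and ((hlin _ _ (by positivity)).and
      ((hlin _ _ hε).and (Filter.eventually_ge_atTop 1)))
  obtain ⟨N, hN⟩ := Filter.eventually_atTop.1 hev
  refine ⟨N, fun n hn => ?_⟩
  obtain ⟨hn1, hn2, hn3, hn4⟩ := hN n hn
  have hn0 : (0 : ℝ) < n := by exact_mod_cast hn4
  have hδ1 : 0 ≤ 1 - δ := by
    by_contra hneg
    nlinarith
  set J : ℕ := ⌊n * (1 - δ) / κ⌋₊ with hJ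
  have hJle : J * κ ≤ n * (1 - δ) := by
    rw [← le_div_iff₀ hκ0]
    exact Nat.floor_le (by positivity)
  have hJge : n * (1 - δ) - κ ≤ J * κ := by
    have := Nat.lt_floor_add_one (n * (1 - δ) / κ)
    rw [div_lt_iff₀ hκ0] at this
    linarith
  obtain ⟨c, dec, herr⟩ := exists_bit_code r hq (n := n) (Nat.mul_le_mul_left J hkm)
    (t := δ / 2 * n) (by positivity) (by
      push_cast
      have : (J : ℝ) * m + J * k * ((1 - (q : ℝ)) / q) = J * κ := by rw [hκ]; ring
      linarith)
  refine ⟨_, c, dec, ?_, herr.trans ?_⟩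
  · calc (2 : ℝ) ^ ((n : ℝ) * (R : ℝ)) = exp (n * ρ) := by
          rw [rpow_def_of_pos (by norm_num), hρ]; ring_nf
      _ ≤ exp (J * (κ * (a - η))) := by
          refine exp_le_exp.2 ?_
          have := mul_le_mul_of_nonneg_right hJge hηa.le
          linarith
      _ = exp (κ * (a - η)) ^ J := exp_nat_mul _ _
      _ ≤ (m.choose k : ℝ) ^ J := by gcongr
      _ ≤ _ := by exact_mod_cast choose_pow_le_choose m k J
  · rw [div_le_iff₀ (by positivity)]
    rw [div_le_iff₀ (by positivity)] at hn3
    have := mul_le_mul_of_nonneg_right hn3 hn0.le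
    nlinarith

/-! ### Value of the genie-aided capacity -/

theorem IsAchievable.outputAndIdleTimes {q r : ℝ} {R : ℝ≥0} (h : IsAchievable q r outputOnly R) :
    IsAchievable q r outputAndIdleTimes R := by
  intro ε hε
  obtain ⟨N, hN⟩ := h ε hε
  refine ⟨N, fun n hn => ?_⟩
  obtain ⟨M, c, dec, hM, herr⟩ := hN n hn
  exact ⟨M, c, fun o => dec o.1, hM, herr⟩

theorem capacity_le_genieCapacity (q r : ℝ) : capacity q r ≤ genieCapacity q r :=
  iSup₂_le fun R hR => le_iSup₂_of_le R hR.outputAndIdleTimes le_rfl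

theorem genieCapacity_eq {q : unitInterval} (r : unitInterval) (hq : 0 < q) {a : ℝ} (ha : 0 < a)
    (h : exp (-a) + exp (-(a / q)) = 1) : genieCapacity q r = ENNReal.ofReal (a / log 2) := by
  refine le_antisymm (iSup₂_le fun R hR => ?_) (le_of_forall_lt fun x hx => ?_)
  · rw [← ENNReal.ofReal_coe_nnreal]
    exact ENNReal.ofReal_le_ofReal (hR.le hq ha h)
  · obtain ⟨R, hxR, hR⟩ := ENNReal.lt_iff_exists_nnreal_btwn.1 hx
    rw [← ENNReal.ofReal_coe_nnreal, ENNReal.ofReal_lt_ofReal_iff'] at hR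
    exact hxR.trans_le (le_iSup₂_of_le R (isAchievable_of_lt r hq ha h hR.1) le_rfl)

theorem geomPos_critical {q : unitInterval} (hq : 0 < q) {a : ℝ} (ha : 0 < a)
    (h : exp (-a) + exp (-(a / q)) = 1) {p : unitInterval} (hp : (p : ℝ) = exp (-(a / q))) :
    entropyBits (geomPos p) =
      ENNReal.ofReal (a / log 2) * (meanPos (geomPos p) + meanNat (geomNat q)) := by
  have hq0 : 0 < (q : ℝ) := hq
  have hq1 : 0 ≤ 1 - (q : ℝ) := sub_nonneg.2 q.2.2
  have hlog : (0 : ℝ) < log 2 := log_pos (by norm_num)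
  have hp0 : 0 < (p : ℝ) := by rw [hp]; exact exp_pos _
  rw [entropyBits_geomPos hp0, meanPos_geomPos hp0, meanNat_geomNat hq,
    ← ENNReal.ofReal_add (by positivity) (by positivity), ← ENNReal.ofReal_mul (by positivity),
    ← closed_form_critical hq0 q.2.2 h, ← hp]
  have : 0 < (q : ℝ) + p * (1 - q) := by positivity
  congr 1
  field_simp

end BEHC

theorem mainTheorem7 (q r : unitInterval) (hq : 0 < q) :
    -- revealing the idle times to the decoder yields an upper bound on the capacity
    BEHC.capacity q r ≤ BEHC.genieCapacity q r ∧
    -- the genie-aided capacity is max over laws of V on {1, 2, ...} of H(V) / (E[V] + E[Z])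
    IsGreatest
      {x : ENNReal | ∃ V : PMF ℕ+, BEHC.meanPos V ≠ ⊤ ∧
        x = BEHC.entropyBits V / (BEHC.meanPos V + BEHC.meanNat (BEHC.geomNat q))}
      (BEHC.genieCapacity q r) ∧
    -- the same maximum, split into the mean μ ≥ 1 and the law given the mean constraint
    IsGreatest
      ((fun μ : ℝ =>
        (⨆ (V : PMF ℕ+) (_ : BEHC.meanPos V ≤ ENNReal.ofReal μ), BEHC.entropyBits V) /
          (ENNReal.ofReal μ + BEHC.meanNat (BEHC.geomNat q))) '' Set.Ici 1)
      (BEHC.genieCapacity q r) ∧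
    -- E[Z] = (1 - q) / q
    BEHC.meanNat (BEHC.geomNat q) = ENNReal.ofReal ((1 - (q : ℝ)) / (q : ℝ)) ∧
    -- the geometric law with parameter 1 / μ maximizes entropy on {1, 2, ...} given E[V] ≤ μ
    (∀ (μ : ℝ) (p : unitInterval), 1 ≤ μ → (p : ℝ) = 1 / μ →
      BEHC.meanPos (BEHC.geomPos p) = ENNReal.ofReal μ ∧
      BEHC.entropyBits (BEHC.geomPos p) = ENNReal.ofReal (BEHC.binEntropyBits p / (p : ℝ)) ∧
      ∀ V : PMF ℕ+, BEHC.meanPos V ≤ ENNReal.ofReal μ →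
        BEHC.entropyBits V ≤ BEHC.entropyBits (BEHC.geomPos p)) ∧
    -- closed form of the genie upper bound
    IsGreatest
      ((fun p : ℝ => ENNReal.ofReal
        ((q : ℝ) * BEHC.binEntropyBits p / ((q : ℝ) + p * (1 - (q : ℝ))))) '' Set.Icc 0 1)
      (BEHC.genieCapacity q r) := by
  have hq0 : 0 < (q : ℝ) := hq
  have hq1 : (q : ℝ) ≤ 1 := q.2.2
  obtain ⟨a, ha, h⟩ := BEHC.exists_exp_add_exp_eq_one hq0 hq1
  have hlt : Real.exp (-(a / (q : ℝ))) < 1 := by linarith [Real.exp_pos (-a)]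
  -- The critical parameter attains all three maxima, with `μ = 1 / p` in the second.
  let p : unitInterval := ⟨Real.exp (-(a / q)), (Real.exp_pos _).le, hlt.le⟩
  have hp : (p : ℝ) = Real.exp (-(a / q)) := rfl
  have hp0 : 0 < p := Real.exp_pos _
  have hZ := BEHC.meanNat_geomNat hq
  have hmean := BEHC.meanPos_geomPos hp0
  have hopt := BEHC.geomPos_critical hq ha h hp
  have hpos : ∀ x : ENNReal, 1 ≤ x → x + BEHC.meanNat (BEHC.geomNat q) ≠ 0 := fun x hx h0 => by
    rw [add_eq_zero] at h0
    simp [h0.1] at hx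
  have hfin : ∀ x : ENNReal, x ≠ ⊤ → x + BEHC.meanNat (BEHC.geomNat q) ≠ ⊤ := fun x hx => by
    rw [hZ]
    exact ENNReal.add_ne_top.2 ⟨hx, ENNReal.ofReal_ne_top⟩
  have hone : ∀ V, 1 ≤ BEHC.meanPos V := fun V => by
    rw [BEHC.meanPos_eq]
    exact le_self_add
  have hμ : 1 ≤ 1 / (p : ℝ) := one_le_one_div hp0 p.2.2
  rw [BEHC.genieCapacity_eq r hq ha h]
  refine ⟨(BEHC.capacity_le_genieCapacity q r).trans_eq (BEHC.genieCapacity_eq r hq ha h),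
    ⟨⟨BEHC.geomPos p, ?_, ?_⟩, ?_⟩, ⟨⟨1 / p, hμ, ?_⟩, ?_⟩, hZ, fun μ p' hμ' hp' => ⟨?_, ?_, ?_⟩,
    ⟨⟨p, p.2, ?_⟩, ?_⟩⟩
  · rw [hmean]
    exact ENNReal.ofReal_ne_top
  · rw [hopt, ENNReal.mul_div_cancel_right (hpos _ (hone _))
      (hfin _ (by rw [hmean]; exact ENNReal.ofReal_ne_top))]
  · rintro x ⟨V, -, rfl⟩
    exact ENNReal.div_le_of_le_mul (BEHC.entropyBits_le_critical hq ha h V)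
  · have hsup : (⨆ (V : PMF ℕ+) (_ : BEHC.meanPos V ≤ ENNReal.ofReal (1 / p)),
        BEHC.entropyBits V) = BEHC.entropyBits (BEHC.geomPos p) :=
      le_antisymm
        (iSup₂_le fun V hV => BEHC.entropyBits_le_geomPos hμ (one_div_one_div (p : ℝ)).symm V hV)
        (le_iSup₂_of_le (BEHC.geomPos p) hmean.le le_rfl)
    dsimp only
    rw [hsup, hopt, ← hmean, ENNReal.mul_div_cancel_right (hpos _ (hone _))
      (hfin _ (by rw [hmean]; exact ENNReal.ofReal_ne_top))]
  · rintro x ⟨μ, -, rfl⟩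
    refine ENNReal.div_le_of_le_mul (iSup₂_le fun V hV => ?_)
    refine (BEHC.entropyBits_le_critical hq ha h V).trans ?_
    gcongr
  · have hp0' : 0 < p' := by
      change 0 < (p' : ℝ)
      rw [hp']
      positivity
    rw [BEHC.meanPos_geomPos hp0', hp', one_div_one_div]
  · refine BEHC.entropyBits_geomPos ?_
    change 0 < (p' : ℝ)
    rw [hp']
    positivity
  · exact BEHC.entropyBits_le_geomPos hμ' hp'
  · exact congrArg ENNReal.ofReal (BEHC.closed_form_critical hq0 hq1 h)
  · rintro x ⟨y, hy, rfl⟩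
    exact ENNReal.ofReal_le_ofReal (BEHC.closed_form_le hq0 hq1 ha h hy.1 hy.2)
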